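/- Let $p\ge 3$, let $0<a_1<a_2<\dots<a_p$ be integers with $\gcd(a_1,\dots,a_p)=1$, and let $S=\langle a_1,\dots,a_p\rangle\subseteq\mathbb N$ be the numerical semigroup they generate. For $s\in\mathbb N$ let ${\sf Z}(s)=\{x\in\mathbb N^p : \sum_i a_ix_i=s\}$ be its set of factorizations; the length of $x$ is ${\rm L}(x)=x_1+\dots+x_p$, and $\mathcal L(s)={\rm L}({\sf Z}(s))$. For $n\in\mathbb N$ put $$W(n)=\{s\in S : n\in\mathcal L(s)\},\qquad \nu(n)=\bigcup_{s\in W(n)}\mathcal L(s).$$ For $A\subseteq\mathbb N$ let $\Delta A$ be the set of differences of consecutive elements of $A$; for a set $Z$ of factorizations put $\Delta(Z)=\Delta({\rm L}(Z))$; write $\Delta\nu(n)=\Delta(\nu(n))$. Let $d=\gcd\{a_{i+1}-a_i : 1\le i\le p-1\}$ and, for $2\le i\le p-1$, let $g_i=\gcd(a_i-a_1,\,a_1-a_p,\,a_p-a_i)$, $$S_i=-\frac{a_2\left(a_1dg_i+(p-2)(a_1-a_i)(a_1-a_p)\right)}{(a_1-a_2)g_i},\qquad S_i'=\frac{a_{p-1}\left((p-2)(a_1-a_p)(a_p-a_i)-da_pg_i\right)}{(a_{p-1}-a_p)g_i},$$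 $$N_S=\left\lceil\max\{S_i,S_i' : 2\le i\le p-1\}\right\rceil.$$ Put $$C_1=\frac{(a_p-a_{p-1})N_S}{a_{p-1}},\quad C_2=\frac{(a_1-a_2)N_S}{a_2},\quad C_3=\left(-\frac{a_p}{a_1}+\frac{a_p}{a_2}-\frac{a_p}{a_{p-1}}+1\right)N_S,\quad C_4=\left(\frac{a_1}{a_{p-1}}-\frac{a_1}{a_p}-\frac{a_1}{a_2}+1\right)N_S,$$ $$\lambda_1=\max(C_1,C_4),\qquad \lambda_2=-\min(C_2,C_3),\qquad N_0=\max\left(\frac{N_S}{a_1},\ \frac{a_p-a_1+\lambda_1+\lambda_2}{a_p-a_1}\right).$$ Then for every integer $n\ge N_0$: 1. $\displaystyle \Delta\nu(n)=\Delta\Big(\bigcup\big\{{\sf Z}(x) : x\in W(n)\cap\big([na_1,\,na_1+\lambda_1]\cup[na_p-\lambda_2,\,na_p]\big)\big\}\Big).$ 2. $\displaystyle \Delta\Big(\bigcup\big\{{\sf Z}(x) : x\in W(n)\cap(na_1+\lambda_1,\,na_p-\lambda_2)\big\}\Big)=\{d\}.$ 3. With $B_3(n)=\{l\in\nu(n)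 : l<\frac{na_1+\lambda_1}{a_p}\}$, $B_1(n)=\{l\in\nu(n) : l>\frac{na_p-\lambda_2}{a_1}\}$ and $B_2(n)=\nu(n)\setminus(B_1(n)\cup B_3(n))$, one has $\Delta B_2(n)=\{d\}$ and $\Delta\nu(n)=\Delta B_1(n)\cup\Delta B_2(n)\cup\Delta B_3(n)$. -/

import Mathlib

/-!
Throughout, `a : Fin (m + 3) → ℕ` is the list of generators `a_1 < ... < a_p` with `p = m + 3`.
The index `0` stands for `a_1`, `1` for `a_2`, `(Fin.last (m + 1)).castSucc` for `a_{p-1}`,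
`Fin.last (m + 2)` for `a_p`; the indices `2, ..., p - 1` are `j.succ.castSucc`, `j : Fin (m + 1)`.
-/

namespace NumSemigroup

/-- The monoid `⟨a_1, ..., a_p⟩` generated by the `a_i`. -/
def monoid {p : ℕ} (a : Fin p → ℕ) : AddSubmonoid ℕ :=
  AddSubmonoid.closure (Set.range a)

/-- The set of factorizations `Z(s)`. -/
def factorizations {p : ℕ} (a : Fin p → ℕ) (s : ℕ) : Set (Fin p → ℕ) :=
  {x | ∑ i, a i * x i = s}

/-- The length of a factorization. -/
def length {p : ℕ} (x : Fin p → ℕ) : ℕ :=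
  ∑ i, x i

/-- The set of lengths of `s`. -/
def lengths {p : ℕ} (a : Fin p → ℕ) (s : ℕ) : Set ℕ :=
  length '' factorizations a s

/-- `W(n)`: the elements of the monoid having a factorization of length `n`. -/
def W {p : ℕ} (a : Fin p → ℕ) (n : ℕ) : Set ℕ :=
  {s | s ∈ monoid a ∧ ∃ x ∈ factorizations a s, length x = n}

/-- `ν(n)`: the union of the sets of lengths of the elements of `W(n)`. -/
def nu {p : ℕ} (a : Fin p → ℕ) (n : ℕ) : Set ℕ :=
  ⋃ s ∈ W a n, lengths a s

/-- The Delta set of a set of natural numbers: the differences of its consecutive elements. -/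
def delta (A : Set ℕ) : Set ℕ :=
  {k | ∃ l ∈ A, ∃ l' ∈ A, l < l' ∧ (∀ y ∈ A, ¬ (l < y ∧ y < l')) ∧ k = l' - l}

/-- The Delta set of a set of factorizations: the Delta set of the set of their lengths. -/
def deltaFact {p : ℕ} (Z : Set (Fin p → ℕ)) : Set ℕ :=
  delta (length '' Z)

/-- `d = gcd {a_{i+1} - a_i}` (the differences are positive for increasing `a`). -/
def d {m : ℕ} (a : Fin (m + 3) → ℕ) : ℕ :=
  Finset.univ.gcd fun j : Fin (m + 2) => a j.succ - a j.castSucc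

/-- `gcd (a_i - a_1, a_1 - a_p, a_p - a_i)`. -/
def gcdAt {m : ℕ} (a : Fin (m + 3) → ℕ) (i : Fin (m + 3)) : ℕ :=
  Int.gcd (Int.gcd ((a i : ℤ) - a 0) ((a 0 : ℤ) - a (Fin.last (m + 2))))
    ((a (Fin.last (m + 2)) : ℤ) - a i)

/-- The rational number `S_i`. Here `p - 2 = m + 1`. -/
def S {m : ℕ} (a : Fin (m + 3) → ℕ) (i : Fin (m + 3)) : ℚ :=
  let a₁ : ℚ := a 0
  let a₂ : ℚ := a 1
  let aₚ : ℚ := a (Fin.last (m + 2))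
  let g : ℚ := gcdAt a i
  (-a₂ * (a₁ * d a * g + (m + 1) * (a₁ - a i) * (a₁ - aₚ))) / ((a₁ - a₂) * g)

/-- The rational number `S'_i`. Here `p - 2 = m + 1` and `b = a_{p-1}`. -/
def S' {m : ℕ} (a : Fin (m + 3) → ℕ) (i : Fin (m + 3)) : ℚ :=
  let a₁ : ℚ := a 0
  let b : ℚ := a (Fin.last (m + 1)).castSucc
  let aₚ : ℚ := a (Fin.last (m + 2))
  let g : ℚ := gcdAt a i
  (b * ((m + 1) * (a₁ - aₚ) * (aₚ - a i) - d a * aₚ * g)) / ((b - aₚ) * g)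

/-- `N_S`: the ceiling of the maximum of all `S_i` and `S'_i`, `i = 2, ..., p - 1`. -/
def NS {m : ℕ} (a : Fin (m + 3) → ℕ) : ℤ :=
  ⌈Finset.univ.sup' Finset.univ_nonempty
    fun j : Fin (m + 1) => max (S a j.succ.castSucc) (S' a j.succ.castSucc)⌉

/-- `C_1 = (a_p - a_{p-1}) N_S / a_{p-1}`. -/
def C₁ {m : ℕ} (a : Fin (m + 3) → ℕ) : ℚ :=
  let b : ℚ := a (Fin.last (m + 1)).castSucc
  let aₚ : ℚ := a (Fin.last (m + 2))
  (aₚ - b) * NS a / b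

/-- `C_2 = (a_1 - a_2) N_S / a_2`. -/
def C₂ {m : ℕ} (a : Fin (m + 3) → ℕ) : ℚ :=
  let a₁ : ℚ := a 0
  let a₂ : ℚ := a 1
  (a₁ - a₂) * NS a / a₂

/-- `C_3 = (-a_p/a_1 + a_p/a_2 - a_p/a_{p-1} + 1) N_S`. -/
def C₃ {m : ℕ} (a : Fin (m + 3) → ℕ) : ℚ :=
  let a₁ : ℚ := a 0
  let a₂ : ℚ := a 1
  let b : ℚ := a (Fin.last (m + 1)).castSucc
  let aₚ : ℚ := a (Fin.last (m + 2))
  (-(aₚ / a₁) + aₚ / a₂ - aₚ / b + 1) * NS a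

/-- `C_4 = (a_1/a_{p-1} - a_1/a_p - a_1/a_2 + 1) N_S`. -/
def C₄ {m : ℕ} (a : Fin (m + 3) → ℕ) : ℚ :=
  let a₁ : ℚ := a 0
  let a₂ : ℚ := a 1
  let b : ℚ := a (Fin.last (m + 1)).castSucc
  let aₚ : ℚ := a (Fin.last (m + 2))
  (a₁ / b - a₁ / aₚ - a₁ / a₂ + 1) * NS a

/-- `λ_1 = max (C_1, C_4)`. -/
def lam₁ {m : ℕ} (a : Fin (m + 3) → ℕ) : ℚ := max (C₁ a) (C₄ a)

/-- `λ_2 = - min (C_2, C_3)`. -/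
def lam₂ {m : ℕ} (a : Fin (m + 3) → ℕ) : ℚ := -min (C₂ a) (C₃ a)

/-- `N_0 = max (N_S / a_1, (a_p - a_1 + λ_1 + λ_2) / (a_p - a_1))`. -/
def N₀ {m : ℕ} (a : Fin (m + 3) → ℕ) : ℚ :=
  let a₁ : ℚ := a 0
  let aₚ : ℚ := a (Fin.last (m + 2))
  max (NS a / a₁) ((aₚ - a₁ + lam₁ a + lam₂ a) / (aₚ - a₁))

/-- `[n a_1, n a_1 + λ_1] ∪ [n a_p - λ_2, n a_p]`. -/
def edges {m : ℕ} (a : Fin (m + 3) → ℕ) (n : ℕ) : Set ℚ :=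
  let a₁ : ℚ := a 0
  let aₚ : ℚ := a (Fin.last (m + 2))
  Set.Icc (n * a₁) (n * a₁ + lam₁ a) ∪ Set.Icc (n * aₚ - lam₂ a) (n * aₚ)

/-- The open interval `(n a_1 + λ_1, n a_p - λ_2)` between the two edges. -/
def inner {m : ℕ} (a : Fin (m + 3) → ℕ) (n : ℕ) : Set ℚ :=
  let a₁ : ℚ := a 0
  let aₚ : ℚ := a (Fin.last (m + 2))
  Set.Ioo (n * a₁ + lam₁ a) (n * aₚ - lam₂ a)

/-- The factorizations of those elements of `W(n)` that lie in the region `R`. -/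
def factorizationsOver {p : ℕ} (a : Fin p → ℕ) (n : ℕ) (R : Set ℚ) : Set (Fin p → ℕ) :=
  ⋃ x ∈ {x : ℕ | x ∈ W a n ∧ (x : ℚ) ∈ R}, factorizations a x

/-- The lower part `B_3(n)` of `ν(n)`: the lengths below `(n a_1 + λ_1) / a_p`. -/
def lowerPart {m : ℕ} (a : Fin (m + 3) → ℕ) (n : ℕ) : Set ℕ :=
  {l ∈ nu a n | (l : ℚ) < (n * a 0 + lam₁ a) / a (Fin.last (m + 2))}

/-- The upper part `B_1(n)` of `ν(n)`: the lengths above `(n a_p - λ_2) / a_1`. -/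
def upperPart {m : ℕ} (a : Fin (m + 3) → ℕ) (n : ℕ) : Set ℕ :=
  {l ∈ nu a n | (l : ℚ) > (n * a (Fin.last (m + 2)) - lam₂ a) / a 0}

/-- The middle part `B_2(n)` of `ν(n)`: what is left. -/
def middlePart {m : ℕ} (a : Fin (m + 3) → ℕ) (n : ℕ) : Set ℕ :=
  nu a n \ (upperPart a n ∪ lowerPart a n)

end NumSemigroup

/-!
An element `s` has a factorization of length `l` as soon as `s ≡ l a_1` modulo `d` and `s` lies in
`[l a_1 + X, l a_p - Y]`, where `X = ∑ (a_i - a_1) (a_p - a_1) / g_i` and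
`Y = ∑ (a_p - a_i) (a_p - a_1) / g_i` run over the intermediate generators
(`hasLength_of_margins`): a Bézout solution of `∑ (a_i - a_1) x_i = s - l a_1` can be reduced modulo
`(a_p - a_1) / g_i` at the intermediate generators. The constant `N_S` is chosen such that
`X + d a_1 ≤ -C_2` and `Y + d a_p ≤ C_1` (`lowMargin_le`, `highMargin_le`), and moreover
`C_4 = -C_2 + (a_1 / a_p) C_1` and `-C_3 = C_1 - (a_p / a_1) C_2`. So `λ_1` and `λ_2` dominate the
margins `X`, `Y`, with room for one further step `d`.

All elements of `ν(n)` are congruent to `n` modulo `d`, since `d` and `a_1` are coprime. Conversely,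
each `l` in this class between the thresholds `(n a_1 + λ_1) / a_p` and `(n a_p - λ_2) / a_1`, and
even one step `d` beyond either of them, is a length of one of the elements `n a_1`, `n a_1 + X`,
`n a_p`, `n a_p - Y` of `W(n)` (`exists_mem_edges`). These lie in the edges, and a length beyond a
threshold can only come from an element in an edge; so the edges give all of `ν(n)`. It also follows
that the middle part of `ν(n)` is an arithmetic progression with difference `d` which continues
inside `ν(n)` by one step on both sides, so that consecutive elements of `ν(n)` in different parts
differ by `d`.

For the elements between the edges, the lower bound on `n` makes the open interval
`(n a_1 + λ_1, n a_p - λ_2)` at least `a_p - a_1` long. Hence for `l ≤ n` it contains one of the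
numbers `l a_p - j (a_p - a_1)` and `l a_p - j (a_p - a_1) - (a_p - a_{p-1})`, which visibly have a
factorization of length `l`; for `l ≥ n` one uses `l a_1 + j (a_p - a_1)` and
`l a_1 + j (a_p - a_1) + (a_2 - a_1)` (`mem_length_inner_iff`).
-/

namespace NumSemigroup

/-! ### Sets of natural numbers with constant difference -/

/-- A set of natural numbers in a single class modulo `k`, closed under adding `k` below each of its
elements, and having at least two elements, has Delta set `{k}`. -/
theorem delta_eq_singleton {A : Set ℕ} {k : ℕ} (hk : 0 < k)
    (hmod : ∀ l ∈ A, ∀ l' ∈ A, (k : ℤ) ∣ (l' : ℤ) - l)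
    (hstep : ∀ l ∈ A, ∀ l' ∈ A, l < l' → l + k ∈ A)
    {l₀ : ℕ} (h₀ : l₀ ∈ A) (h₁ : l₀ + k ∈ A) : delta A = {k} := by
  have hle : ∀ l ∈ A, ∀ l' ∈ A, l < l' → l + k ≤ l' := by
    intro l hl l' hl' hlt
    have := Int.le_of_dvd (by omega) (hmod l hl l' hl')
    omega
  ext t
  simp only [delta, Set.mem_ofPred_eq, Set.mem_singleton_iff]
  constructor
  · rintro ⟨l, hl, l', hl', hlt, hno, rfl⟩
    have h1 := hle l hl l' hl' hlt
    have h2 := hno _ (hstep l hl l' hl' hlt)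
    omega
  · rintro rfl
    refine ⟨l₀, h₀, l₀ + t, h₁, by omega, ?_, by omega⟩
    rintro y hy ⟨h2, h3⟩
    have := hle l₀ h₀ y hy h2
    omega

/-- The Delta set of an order-convex part of `A` is contained in that of `A`. -/
theorem delta_subset_of_ordConvex {A B : Set ℕ} (hBA : B ⊆ A)
    (hconv : ∀ l ∈ B, ∀ l' ∈ B, ∀ y ∈ A, l < y → y < l' → y ∈ B) : delta B ⊆ delta A := by
  rintro t ⟨l, hl, l', hl', hlt, hno, rfl⟩
  exact ⟨l, hBA hl, l', hBA hl', hlt,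
    fun y hy h => hno y (hconv l hl l' hl' y hy h.1 h.2) h, rfl⟩

variable {m : ℕ} (a : Fin (m + 3) → ℕ)

/-! ### Factorizations of a given length -/

/-- `s` has a factorization of length `l`. -/
def HasLength (l s : ℕ) : Prop := ∃ x ∈ factorizations a s, length x = l

theorem sum_mul_mem_monoid (x : Fin (m + 3) → ℕ) : ∑ i, a i * x i ∈ monoid a := by
  refine AddSubmonoid.sum_mem _ fun i _ => ?_
  rw [mul_comm, ← smul_eq_mul]
  exact AddSubmonoid.nsmul_mem _ (AddSubmonoid.subset_closure (Set.mem_range_self i)) _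

theorem mem_W_iff {n s : ℕ} : s ∈ W a n ↔ HasLength a n s := by
  refine ⟨fun h => h.2, fun h => ⟨?_, h⟩⟩
  obtain ⟨x, hx, -⟩ := h
  rw [← show ∑ i, a i * x i = s from hx]
  exact sum_mul_mem_monoid a x

theorem mem_nu_iff {n l : ℕ} : l ∈ nu a n ↔ ∃ s, HasLength a n s ∧ HasLength a l s := by
  simp only [nu, Set.mem_iUnion, mem_W_iff, exists_prop, lengths, Set.mem_image, HasLength]

theorem mem_length_factorizationsOver_iff {n l : ℕ} {R : Set ℚ} :
    l ∈ length '' factorizationsOver a n R ↔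
      ∃ s, HasLength a n s ∧ HasLength a l s ∧ (s : ℚ) ∈ R := by
  simp only [factorizationsOver, Set.mem_image, Set.mem_iUnion, Set.mem_ofPred_eq, mem_W_iff,
    exists_prop]
  constructor
  · rintro ⟨x, ⟨s, ⟨h1, h2⟩, h3⟩, rfl⟩
    exact ⟨s, h1, ⟨x, h3, rfl⟩, h2⟩
  · rintro ⟨s, h1, ⟨x, h3, rfl⟩, h2⟩
    exact ⟨x, ⟨s, ⟨h1, h2⟩, h3⟩, rfl⟩

theorem hasLength_iff {l s : ℕ} :
    HasLength a l s ↔ ∃ x : Fin (m + 3) → ℕ, ∑ i, a i * x i = s ∧ ∑ i, x i = l := Iff.rfl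

/-- Integer multiplicities suffice, as long as they are nonnegative: `x` at `a_1`, `y` at the
intermediate generators and `z` at `a_p`. -/
theorem hasLength_of_int {l s : ℕ} (x : ℤ) (y : Fin (m + 1) → ℤ) (z : ℤ) (hx : 0 ≤ x)
    (hy : ∀ j, 0 ≤ y j) (hz : 0 ≤ z)
    (hs : a 0 * x + ∑ j : Fin (m + 1), (a j.succ.castSucc : ℤ) * y j + a (Fin.last (m + 2)) * z = s)
    (hl : x + ∑ j, y j + z = l) : HasLength a l s := by
  lift x to ℕ using hx
  lift y to Fin (m + 1) → ℕ using hy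
  lift z to ℕ using hz
  refine (hasLength_iff a).2 ⟨Fin.snoc (α := fun _ => ℕ) (Fin.cons (α := fun _ => ℕ) x y) z, ?_, ?_⟩
  · rw [Fin.sum_univ_castSucc, Fin.sum_univ_succ]
    simp only [Fin.snoc_castSucc, Fin.snoc_last, Fin.cons_succ, ← Fin.castSucc_zero]
    simp only [Fin.castSucc_zero, Fin.cons_zero]
    beta_reduce at hs
    exact_mod_cast hs
  · rw [Fin.sum_univ_castSucc, Fin.sum_univ_succ]
    simp only [Fin.snoc_castSucc, Fin.snoc_last, Fin.cons_zero, Fin.cons_succ]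
    beta_reduce at hl
    exact_mod_cast hl

/-- Factorizations using only `a_1`, `a_p` and at most one copy of `a_i`. -/
theorem hasLength_of_three {l s : ℕ} (i : Fin (m + 3)) (x e z : ℕ)
    (hs : a 0 * x + a i * e + a (Fin.last (m + 2)) * z = s) (hl : x + e + z = l) :
    HasLength a l s := by
  refine (hasLength_iff a).2 ⟨Pi.single 0 x + Pi.single i e + Pi.single (Fin.last (m + 2)) z, ?_, ?_⟩
  · simp [mul_add, Finset.sum_add_distrib, Pi.single_apply, hs]
  · simp [Finset.sum_add_distrib, hl]

variable {a}

theorem HasLength.mul_le {l s : ℕ} (ha : StrictMono a) (h : HasLength a l s) : l * a 0 ≤ s := by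
  obtain ⟨x, rfl, rfl⟩ := (hasLength_iff a).1 h
  rw [Finset.sum_mul]
  refine Finset.sum_le_sum fun i _ => ?_
  rw [mul_comm]
  exact Nat.mul_le_mul_right _ (ha.monotone (Fin.zero_le i))

theorem HasLength.le_mul {l s : ℕ} (ha : StrictMono a) (h : HasLength a l s) :
    s ≤ l * a (Fin.last (m + 2)) := by
  obtain ⟨x, rfl, rfl⟩ := (hasLength_iff a).1 h
  rw [Finset.sum_mul]
  refine Finset.sum_le_sum fun i _ => ?_
  rw [mul_comm (x i)]
  exact Nat.mul_le_mul_right _ (ha.monotone (Fin.le_last i))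

/-! ### Congruences modulo `d` -/

theorem d_dvd_sub (ha : StrictMono a) (i : Fin (m + 3)) : (d a : ℤ) ∣ (a i : ℤ) - a 0 := by
  induction i using Fin.induction with
  | zero => simp
  | succ j ih =>
    have h1 : d a ∣ a j.succ - a j.castSucc := Finset.gcd_dvd (Finset.mem_univ j)
    have h2 : a j.castSucc ≤ a j.succ := ha.monotone (Fin.castSucc_lt_succ).le
    have h3 := Int.natCast_dvd_natCast.2 h1
    rw [Nat.cast_sub h2] at h3
    have := dvd_add h3 ih
    simpa using this

theorem d_pos (ha : StrictMono a) : 0 < d a := by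
  have h := d_dvd_sub ha (Fin.last (m + 2))
  have h1 : a 0 < a (Fin.last (m + 2)) := ha (Fin.last_pos)
  rcases Nat.eq_zero_or_pos (d a) with h0 | h0
  · rw [h0] at h
    simp at h
    omega
  · exact h0

/-- `d` is an integral combination of the differences `a_i - a_1`. -/
theorem exists_sum_eq_of_d_dvd (ha : StrictMono a) {t : ℤ} (ht : (d a : ℤ) ∣ t) :
    ∃ z : Fin (m + 3) → ℤ, ∑ i, z i * ((a i : ℤ) - a 0) = t := by
  rw [← Ideal.mem_span_range_iff_exists_fun]
  set I := Ideal.span (Set.range fun i => (a i : ℤ) - a 0) with hI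
  have hmem : ∀ i, (a i : ℤ) - a 0 ∈ I := fun i => Ideal.subset_span ⟨i, rfl⟩
  obtain ⟨g, hg⟩ := (IsPrincipalIdealRing.principal I).principal
  have hg' : ∀ z, z ∈ I ↔ g ∣ z := fun z => by rw [hg]; exact Ideal.mem_span_singleton
  rw [hg']
  refine dvd_trans ?_ ht
  rw [← Int.natAbs_dvd, Int.natCast_dvd_natCast]
  refine Finset.dvd_gcd fun j _ => ?_
  have h2 : a j.castSucc ≤ a j.succ := ha.monotone (Fin.castSucc_lt_succ).le
  rw [← Int.natCast_dvd_natCast, Nat.cast_sub h2, Int.natAbs_dvd, ← hg']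
  have := I.sub_mem (hmem j.succ) (hmem j.castSucc)
  simpa using this

theorem isCoprime_d (ha : StrictMono a) (hgcd : Finset.univ.gcd a = 1) :
    IsCoprime (d a : ℤ) (a 0 : ℤ) := by
  rw [Nat.isCoprime_iff_coprime, Nat.coprime_iff_gcd_eq_one, ← Nat.dvd_one, ← hgcd]
  refine Finset.dvd_gcd fun i _ => ?_
  have h1 : ((Nat.gcd (d a) (a 0) : ℕ) : ℤ) ∣ (a i : ℤ) - a 0 :=
    (Int.natCast_dvd_natCast.2 (Nat.gcd_dvd_left _ _)).trans (d_dvd_sub ha i)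
  have h2 : ((Nat.gcd (d a) (a 0) : ℕ) : ℤ) ∣ a 0 :=
    Int.natCast_dvd_natCast.2 (Nat.gcd_dvd_right _ _)
  rw [← Int.natCast_dvd_natCast]
  simpa using dvd_add h1 h2

theorem HasLength.d_dvd {l s : ℕ} (ha : StrictMono a) (h : HasLength a l s) :
    (d a : ℤ) ∣ (s : ℤ) - l * a 0 := by
  obtain ⟨x, rfl, rfl⟩ := (hasLength_iff a).1 h
  have : ((∑ i, a i * x i : ℕ) : ℤ) - ((∑ i, x i : ℕ) : ℤ) * a 0
      = ∑ i, ((a i : ℤ) - a 0) * x i := by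
    push_cast
    rw [Finset.sum_mul, ← Finset.sum_sub_distrib]
    exact Finset.sum_congr rfl fun i _ => by ring
  rw [this]
  exact Finset.dvd_sum fun i _ => (d_dvd_sub ha i).mul_right _

theorem d_dvd_of_mem_nu (ha : StrictMono a) (hgcd : Finset.univ.gcd a = 1) {n l : ℕ}
    (h : l ∈ nu a n) : (d a : ℤ) ∣ (l : ℤ) - n := by
  obtain ⟨s, h1, h2⟩ := (mem_nu_iff a).1 h
  refine (isCoprime_d ha hgcd).dvd_of_dvd_mul_right ?_
  rw [show ((l : ℤ) - n) * a 0 = s - n * a 0 - (s - l * a 0) by ring]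
  exact dvd_sub (h1.d_dvd ha) (h2.d_dvd ha)

/-! ### A sufficient condition for having a factorization of given length -/

variable (a)

/-- `(a_p - a_1) / g_i`: adding it to the multiplicity of `a_i` can be compensated by changing the
multiplicities of `a_1` and `a_p` only. -/
def period (i : Fin (m + 3)) : ℤ := ((a (Fin.last (m + 2)) : ℤ) - a 0) / gcdAt a i

/-- `X = ∑ (a_i - a_1) (a_p - a_1) / g_i`, the sum over the intermediate generators. -/
def lowMargin : ℤ :=
  ∑ j : Fin (m + 1), ((a j.succ.castSucc : ℤ) - a 0) * period a j.succ.castSucc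

/-- `Y = ∑ (a_p - a_i) (a_p - a_1) / g_i`, the sum over the intermediate generators. -/
def highMargin : ℤ :=
  ∑ j : Fin (m + 1),
    ((a (Fin.last (m + 2)) : ℤ) - a j.succ.castSucc) * period a j.succ.castSucc

variable {a}

theorem gcdAt_dvd_sub_zero (i : Fin (m + 3)) : (gcdAt a i : ℤ) ∣ (a i : ℤ) - a 0 :=
  (Int.gcd_dvd_left _ _).trans (Int.gcd_dvd_left _ _)

theorem gcdAt_dvd_last_sub_zero (i : Fin (m + 3)) :
    (gcdAt a i : ℤ) ∣ (a (Fin.last (m + 2)) : ℤ) - a 0 := by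
  rw [← dvd_neg, neg_sub]
  exact (Int.gcd_dvd_left _ _).trans (Int.gcd_dvd_right _ _)

theorem zero_lt_last (ha : StrictMono a) : (a 0 : ℤ) < a (Fin.last (m + 2)) := by
  exact_mod_cast ha Fin.last_pos

theorem gcdAt_pos (ha : StrictMono a) (i : Fin (m + 3)) : (0 : ℤ) < gcdAt a i := by
  have h := gcdAt_dvd_last_sub_zero (a := a) i
  have h1 := zero_lt_last ha
  rcases (Int.natCast_nonneg (gcdAt a i)).eq_or_lt with h0 | h0
  · rw [← h0, zero_dvd_iff] at h
    omega
  · exact h0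

theorem gcdAt_mul_period (i : Fin (m + 3)) :
    (gcdAt a i : ℤ) * period a i = (a (Fin.last (m + 2)) : ℤ) - a 0 :=
  Int.mul_ediv_cancel' (gcdAt_dvd_last_sub_zero i)

theorem period_pos (ha : StrictMono a) (i : Fin (m + 3)) : 0 < period a i := by
  have h1 := gcdAt_mul_period (a := a) i
  have h2 := zero_lt_last ha
  exact pos_of_mul_pos_right (h1 ▸ by omega) (gcdAt_pos ha i).le

theorem dvd_sub_mul_period (i : Fin (m + 3)) :
    ((a (Fin.last (m + 2)) : ℤ) - a 0) ∣ ((a i : ℤ) - a 0) * period a i := by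
  obtain ⟨c, hc⟩ := gcdAt_dvd_sub_zero (a := a) i
  exact ⟨c, by rw [hc, ← gcdAt_mul_period (a := a) i]; ring⟩

theorem lowMargin_nonneg (ha : StrictMono a) : 0 ≤ lowMargin a := by
  refine Finset.sum_nonneg fun j _ => mul_nonneg ?_ (period_pos ha _).le
  have : a 0 ≤ a j.succ.castSucc := ha.monotone (Fin.zero_le _)
  omega

theorem highMargin_nonneg (ha : StrictMono a) : 0 ≤ highMargin a := by
  refine Finset.sum_nonneg fun j _ => mul_nonneg ?_ (period_pos ha _).le
  have : a j.succ.castSucc ≤ a (Fin.last (m + 2)) := ha.monotone (Fin.le_last _)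
  omega

theorem d_dvd_lowMargin (ha : StrictMono a) : (d a : ℤ) ∣ lowMargin a :=
  Finset.dvd_sum fun _ _ => (d_dvd_sub ha _).mul_right _

theorem d_dvd_highMargin (ha : StrictMono a) : (d a : ℤ) ∣ highMargin a :=
  Finset.dvd_sum fun j _ => by
    have := dvd_sub (d_dvd_sub ha (Fin.last (m + 2))) (d_dvd_sub ha j.succ.castSucc)
    rw [sub_sub_sub_cancel_right] at this
    exact this.mul_right _

/-- If `s ≡ l a_1` modulo `d` and `s` lies in `[l a_1 + X, l a_p - Y]`, then `s` has a factorization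
of length `l`: an integral solution is reduced modulo the periods at the intermediate generators,
and the margins make the multiplicities of `a_1` and `a_p` nonnegative. -/
theorem hasLength_of_margins (ha : StrictMono a) {l s : ℕ}
    (hd : (d a : ℤ) ∣ (s : ℤ) - l * a 0) (hlow : lowMargin a ≤ (s : ℤ) - l * a 0)
    (hhigh : highMargin a ≤ (l : ℤ) * a (Fin.last (m + 2)) - s) : HasLength a l s := by
  obtain ⟨z, hz⟩ := exists_sum_eq_of_d_dvd ha hd
  have hD := zero_lt_last ha
  rw [Fin.sum_univ_castSucc, Fin.sum_univ_succ] at hz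
  simp only [Fin.castSucc_zero, sub_self, mul_zero, zero_add] at hz
  set y : Fin (m + 1) → ℤ := fun j => z j.succ.castSucc % period a j.succ.castSucc with hy
  have hy0 : ∀ j, 0 ≤ y j := fun j => Int.emod_nonneg _ (period_pos ha _).ne'
  have hy1 : ∀ j, y j ≤ period a j.succ.castSucc := fun j =>
    (Int.emod_lt_of_pos _ (period_pos ha _)).le
  have hlow' : ∑ j : Fin (m + 1), ((a j.succ.castSucc : ℤ) - a 0) * y j ≤ lowMargin a := by
    refine Finset.sum_le_sum fun j _ => mul_le_mul_of_nonneg_left (hy1 j) ?_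
    have : a 0 ≤ a j.succ.castSucc := ha.monotone (Fin.zero_le _)
    omega
  have hhigh' : ∑ j : Fin (m + 1), ((a (Fin.last (m + 2)) : ℤ) - a j.succ.castSucc) * y j
      ≤ highMargin a := by
    refine Finset.sum_le_sum fun j _ => mul_le_mul_of_nonneg_left (hy1 j) ?_
    have : a j.succ.castSucc ≤ a (Fin.last (m + 2)) := ha.monotone (Fin.le_last _)
    omega
  have hdvd : ((a (Fin.last (m + 2)) : ℤ) - a 0) ∣
      (s : ℤ) - l * a 0 - ∑ j : Fin (m + 1), ((a j.succ.castSucc : ℤ) - a 0) * y j := by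
    have h1 : (s : ℤ) - l * a 0 - ∑ j : Fin (m + 1), ((a j.succ.castSucc : ℤ) - a 0) * y j
        = ∑ j : Fin (m + 1), ((a j.succ.castSucc : ℤ) - a 0) * period a j.succ.castSucc *
            (z j.succ.castSucc / period a j.succ.castSucc)
          + z (Fin.last (m + 2)) * ((a (Fin.last (m + 2)) : ℤ) - a 0) := by
      rw [← hz, add_sub_right_comm, ← Finset.sum_sub_distrib]
      congr 1
      refine Finset.sum_congr rfl fun j _ => ?_
      have := Int.emod_add_mul_ediv (z j.succ.castSucc) (period a j.succ.castSucc)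
      simp only [hy]
      linear_combination (-((a j.succ.castSucc : ℤ) - a 0)) * this
    rw [h1]
    exact dvd_add (Finset.dvd_sum fun j _ => (dvd_sub_mul_period _).mul_right _)
      (Dvd.intro_left _ rfl)
  obtain ⟨w, hw⟩ := hdvd
  have e1 : ∑ j : Fin (m + 1), ((a j.succ.castSucc : ℤ) - a 0) * y j
      = ∑ j : Fin (m + 1), (a j.succ.castSucc : ℤ) * y j - a 0 * ∑ j, y j := by
    rw [Finset.mul_sum, ← Finset.sum_sub_distrib]
    exact Finset.sum_congr rfl fun j _ => by ring
  have e2 : ∑ j : Fin (m + 1), ((a (Fin.last (m + 2)) : ℤ) - a j.succ.castSucc) * y j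
      = a (Fin.last (m + 2)) * ∑ j, y j - ∑ j : Fin (m + 1), (a j.succ.castSucc : ℤ) * y j := by
    rw [Finset.mul_sum, ← Finset.sum_sub_distrib]
    exact Finset.sum_congr rfl fun j _ => by ring
  refine hasLength_of_int a (l - ∑ j, y j - w) y w ?_ hy0 ?_ ?_ (by ring)
  · refine nonneg_of_mul_nonneg_right (a := (a (Fin.last (m + 2)) : ℤ) - a 0) ?_ (by omega)
    nlinarith
  · refine nonneg_of_mul_nonneg_right (a := (a (Fin.last (m + 2)) : ℤ) - a 0) ?_ (by omega)
    nlinarith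
  · linear_combination -hw - e1

/-! ### The constants of the statement in terms of the margins -/

theorem S_le_NS (j : Fin (m + 1)) : S a j.succ.castSucc ≤ NS a :=
  ((le_max_left _ _).trans (Finset.le_sup' (fun j : Fin (m + 1) =>
    max (S a j.succ.castSucc) (S' a j.succ.castSucc)) (Finset.mem_univ j))).trans (Int.le_ceil _)

theorem S'_le_NS (j : Fin (m + 1)) : S' a j.succ.castSucc ≤ NS a :=
  ((le_max_right _ _).trans (Finset.le_sup' (fun j : Fin (m + 1) =>
    max (S a j.succ.castSucc) (S' a j.succ.castSucc)) (Finset.mem_univ j))).trans (Int.le_ceil _)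

theorem period_cast (ha : StrictMono a) (i : Fin (m + 3)) :
    (period a i : ℚ) = ((a (Fin.last (m + 2)) : ℚ) - a 0) / gcdAt a i := by
  have h := gcdAt_mul_period (a := a) i
  have h0 : (gcdAt a i : ℚ) ≠ 0 := by exact_mod_cast (gcdAt_pos ha i).ne'
  rw [eq_div_iff h0, mul_comm]
  exact_mod_cast h

theorem zero_lt_one_index (ha : StrictMono a) : (a 0 : ℚ) < a 1 := by
  exact_mod_cast ha (by simp)

theorem penultimate_lt_last (ha : StrictMono a) :
    (a (Fin.last (m + 1)).castSucc : ℚ) < a (Fin.last (m + 2)) := by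
  exact_mod_cast ha (Fin.castSucc_lt_last _)

theorem zero_lt_penultimate (ha : StrictMono a) :
    (a 0 : ℚ) < a (Fin.last (m + 1)).castSucc := by
  exact_mod_cast ha (by simp [Fin.lt_def])

theorem lowMargin_le (ha_pos : 0 < a 0) (ha : StrictMono a) :
    (lowMargin a : ℚ) + a 0 * d a ≤ -C₂ a := by
  have h0 : (0 : ℚ) < a 0 := by exact_mod_cast ha_pos
  have h1 := zero_lt_one_index ha
  have hterm : ∀ j : Fin (m + 1), (((a j.succ.castSucc : ℤ) - a 0) * period a j.succ.castSucc : ℚ)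
      ≤ (-C₂ a - a 0 * d a) / (m + 1) := by
    intro j
    have hS := S_le_NS (a := a) j
    have hg : (0 : ℚ) < gcdAt a j.succ.castSucc := by exact_mod_cast gcdAt_pos ha j.succ.castSucc
    rw [period_cast ha, le_div_iff₀ (by positivity)]
    have e : ((a j.succ.castSucc : ℤ) - a 0 : ℚ) *
        (((a (Fin.last (m + 2)) : ℚ) - a 0) / gcdAt a j.succ.castSucc) * (m + 1)
        = S a j.succ.castSucc * ((a 1 - a 0) / a 1) - a 0 * d a := by
      simp only [S]
      have h2 : (a 0 : ℚ) - a 1 ≠ 0 := by linarith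
      have h3 : (a 1 : ℚ) ≠ 0 := by linarith
      push_cast
      field_simp
      ring
    have e' : -C₂ a = NS a * ((a 1 - a 0) / a 1) := by
      simp only [C₂]
      ring
    rw [e, e']
    have : (0 : ℚ) ≤ (a 1 - a 0) / a 1 := div_nonneg (by linarith) (by linarith)
    have := mul_le_mul_of_nonneg_right hS this
    linarith
  have hsum := Finset.sum_le_sum fun j (_ : j ∈ Finset.univ) => hterm j
  rw [Finset.sum_const, Finset.card_univ, Fintype.card_fin, nsmul_eq_mul] at hsum
  have hm : ((m + 1 : ℕ) : ℚ) * ((-C₂ a - a 0 * d a) / (m + 1)) = -C₂ a - a 0 * d a := by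
    push_cast
    field_simp
  rw [hm] at hsum
  simp only [lowMargin]
  push_cast at hsum ⊢
  linarith

theorem highMargin_le (ha_pos : 0 < a 0) (ha : StrictMono a) :
    (highMargin a : ℚ) + a (Fin.last (m + 2)) * d a ≤ C₁ a := by
  have h0 : (0 : ℚ) < a 0 := by exact_mod_cast ha_pos
  have h1 := zero_lt_penultimate ha
  have h1' := penultimate_lt_last ha
  have hterm : ∀ j : Fin (m + 1),
      (((a (Fin.last (m + 2)) : ℤ) - a j.succ.castSucc) * period a j.succ.castSucc : ℚ)
      ≤ (C₁ a - a (Fin.last (m + 2)) * d a) / (m + 1) := by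
    intro j
    have hS := S'_le_NS (a := a) j
    have hg : (0 : ℚ) < gcdAt a j.succ.castSucc := by exact_mod_cast gcdAt_pos ha j.succ.castSucc
    rw [period_cast ha, le_div_iff₀ (by positivity)]
    have e : ((a (Fin.last (m + 2)) : ℤ) - a j.succ.castSucc : ℚ) *
        (((a (Fin.last (m + 2)) : ℚ) - a 0) / gcdAt a j.succ.castSucc) * (m + 1)
        = S' a j.succ.castSucc * ((a (Fin.last (m + 2)) - a (Fin.last (m + 1)).castSucc)
            / a (Fin.last (m + 1)).castSucc) - a (Fin.last (m + 2)) * d a := by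
      simp only [S']
      have h2 : (a (Fin.last (m + 1)).castSucc : ℚ) - a (Fin.last (m + 2)) ≠ 0 := by linarith
      have h3 : (a (Fin.last (m + 1)).castSucc : ℚ) ≠ 0 := by linarith
      push_cast
      field_simp
      ring
    have e' : C₁ a = NS a * ((a (Fin.last (m + 2)) - a (Fin.last (m + 1)).castSucc)
            / a (Fin.last (m + 1)).castSucc) := by
      simp only [C₁]
      ring
    rw [e, e']
    have : (0 : ℚ) ≤ (a (Fin.last (m + 2)) - a (Fin.last (m + 1)).castSucc)
            / a (Fin.last (m + 1)).castSucc := div_nonneg (by linarith) (by linarith)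
    have := mul_le_mul_of_nonneg_right hS this
    linarith
  have hsum := Finset.sum_le_sum fun j (_ : j ∈ Finset.univ) => hterm j
  rw [Finset.sum_const, Finset.card_univ, Fintype.card_fin, nsmul_eq_mul] at hsum
  have hm : ((m + 1 : ℕ) : ℚ) * ((C₁ a - a (Fin.last (m + 2)) * d a) / (m + 1))
      = C₁ a - a (Fin.last (m + 2)) * d a := by
    push_cast
    field_simp
  rw [hm] at hsum
  simp only [highMargin]
  push_cast at hsum ⊢
  linarith

theorem C₄_eq (ha_pos : 0 < a 0) (ha : StrictMono a) :
    C₄ a = -C₂ a + a 0 / a (Fin.last (m + 2)) * C₁ a := by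
  have h0 : (0 : ℚ) < a 0 := by exact_mod_cast ha_pos
  have h1 := zero_lt_one_index ha
  have h2 := zero_lt_penultimate ha
  have h3 := penultimate_lt_last ha
  have : (a 1 : ℚ) ≠ 0 := by linarith
  have : (a (Fin.last (m + 1)).castSucc : ℚ) ≠ 0 := by linarith
  have : (a (Fin.last (m + 2)) : ℚ) ≠ 0 := by linarith
  simp only [C₄, C₂, C₁]
  field_simp
  ring

theorem neg_C₃_eq (ha_pos : 0 < a 0) (ha : StrictMono a) :
    a 0 * -C₃ a = a 0 * C₁ a + a (Fin.last (m + 2)) * -C₂ a := by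
  have h0 : (0 : ℚ) < a 0 := by exact_mod_cast ha_pos
  have h1 := zero_lt_one_index ha
  have h2 := zero_lt_penultimate ha
  have : (a 1 : ℚ) ≠ 0 := by linarith
  have : (a (Fin.last (m + 1)).castSucc : ℚ) ≠ 0 := by linarith
  simp only [C₃, C₂, C₁]
  field_simp
  ring

theorem highMargin_le_lam₁ (ha_pos : 0 < a 0) (ha : StrictMono a) :
    (highMargin a : ℚ) + a (Fin.last (m + 2)) * d a ≤ lam₁ a :=
  (highMargin_le ha_pos ha).trans (le_max_left _ _)

theorem lowMargin_le_lam₁ (ha_pos : 0 < a 0) (ha : StrictMono a) :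
    (lowMargin a : ℚ) + a 0 * d a ≤ lam₁ a := by
  refine le_trans ?_ (le_max_right _ _)
  rw [C₄_eq ha_pos ha]
  have h1 : (0 : ℚ) ≤ C₁ a := by
    refine le_trans ?_ (highMargin_le ha_pos ha)
    have : (0 : ℚ) ≤ highMargin a := by exact_mod_cast highMargin_nonneg ha
    positivity
  have h2 : 0 ≤ (a 0 : ℚ) / a (Fin.last (m + 2)) * C₁ a := by positivity
  linarith [lowMargin_le ha_pos ha]

theorem lowMargin_le_lam₂ (ha_pos : 0 < a 0) (ha : StrictMono a) :
    (lowMargin a : ℚ) + a 0 * d a ≤ lam₂ a :=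
  (lowMargin_le ha_pos ha).trans (neg_le_neg (min_le_left _ _))

theorem mul_margins_le_mul_lam₂ (ha_pos : 0 < a 0) (ha : StrictMono a) :
    (a 0 : ℚ) * (highMargin a + a (Fin.last (m + 2)) * d a)
      + a (Fin.last (m + 2)) * (lowMargin a + a 0 * d a) ≤ a 0 * lam₂ a := by
  have h1 : a 0 * -C₃ a ≤ a 0 * lam₂ a :=
    mul_le_mul_of_nonneg_left (neg_le_neg (min_le_right _ _)) (by positivity)
  rw [neg_C₃_eq ha_pos ha] at h1
  have h2 := mul_le_mul_of_nonneg_left (highMargin_le ha_pos ha) (Nat.cast_nonneg (a 0))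
  have h3 := mul_le_mul_of_nonneg_left (lowMargin_le ha_pos ha)
    (Nat.cast_nonneg (a (Fin.last (m + 2))))
  linarith

theorem highMargin_le_lam₂ (ha_pos : 0 < a 0) (ha : StrictMono a) :
    (highMargin a : ℚ) + a (Fin.last (m + 2)) * d a ≤ lam₂ a := by
  have h0 : (0 : ℚ) < a 0 := by exact_mod_cast ha_pos
  have h1 := mul_margins_le_mul_lam₂ ha_pos ha
  have h2 : (0 : ℚ) ≤ lowMargin a := by exact_mod_cast lowMargin_nonneg ha
  refine le_of_mul_le_mul_left (le_trans ?_ h1) h0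
  have : 0 ≤ (a (Fin.last (m + 2)) : ℚ) * (lowMargin a + a 0 * d a) := by positivity
  linarith

theorem le_mul_of_N₀_le (ha : StrictMono a) {n : ℕ} (hn : N₀ a ≤ n) :
    (a (Fin.last (m + 2)) : ℚ) - a 0 + lam₁ a + lam₂ a
      ≤ n * a (Fin.last (m + 2)) - n * a 0 := by
  have hD : (a 0 : ℚ) < a (Fin.last (m + 2)) := by exact_mod_cast zero_lt_last ha
  have := (le_max_right _ _).trans hn
  rw [div_le_iff₀ (by linarith)] at this
  linarith

/-! ### Every length of the right class between the two thresholds -/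

/-- Every `l ≤ n` with `l ≡ n` modulo `d` and `l a_p ≥ n a_1 + λ₁ - d a_p` is a length of an element
of `W(n)` in an edge: of `n a_1`, or of `n a_1 + X` if `l` is too close to `n` for the margin
condition. The slack `d a_p` means that the first such `l` may lie one step below the threshold. -/
theorem exists_mem_edges_of_le (ha_pos : 0 < a 0) (ha : StrictMono a) {n l : ℕ} (hn : N₀ a ≤ n)
    (hd : (d a : ℤ) ∣ (l : ℤ) - n) (hln : l ≤ n)
    (h : n * a 0 + lam₁ a - a (Fin.last (m + 2)) * d a ≤ (l : ℚ) * a (Fin.last (m + 2))) :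
    ∃ s, HasLength a n s ∧ HasLength a l s ∧ (s : ℚ) ∈ edges a n := by
  have hN := le_mul_of_N₀_le ha hn
  have h0 : (0 : ℚ) < a 0 := by exact_mod_cast ha_pos
  have hD : (a 0 : ℚ) < a (Fin.last (m + 2)) := by exact_mod_cast zero_lt_last ha
  have hX : (0 : ℚ) ≤ lowMargin a := by exact_mod_cast lowMargin_nonneg ha
  have hY : (0 : ℚ) ≤ highMargin a := by exact_mod_cast highMargin_nonneg ha
  have had : (0 : ℚ) ≤ a 0 * d a := by positivity
  have hapd : (0 : ℚ) ≤ a (Fin.last (m + 2)) * d a := by positivity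
  have hl1 := lowMargin_le_lam₁ ha_pos ha
  have hl2 := highMargin_le_lam₁ ha_pos ha
  have hdl : (d a : ℤ) ∣ (n : ℤ) * a 0 - l * a 0 := by
    rw [← sub_mul, ← neg_sub, neg_mul, dvd_neg]
    exact hd.mul_right _
  by_cases hc : (lowMargin a : ℚ) ≤ n * a 0 - l * a 0
  · refine ⟨n * a 0, hasLength_of_three a 0 n 0 0 (by ring) (by ring),
      hasLength_of_margins ha (by exact_mod_cast hdl) (by exact_mod_cast hc) ?_, ?_⟩
    · have : (highMargin a : ℚ) ≤ l * a (Fin.last (m + 2)) - (n * a 0 : ℕ) := by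
        push_cast; linarith
      exact_mod_cast this
    · refine Or.inl ⟨?_, ?_⟩ <;> push_cast <;> linarith
  · obtain ⟨X, hXe⟩ := Int.eq_ofNat_of_zero_le (lowMargin_nonneg ha)
    have hXd := d_dvd_lowMargin ha
    rw [hXe] at hc hX hl1 hXd
    push_cast at hc hX hl1
    have hlamX := mul_margins_le_mul_lam₂ ha_pos ha
    rw [hXe] at hlamX
    push_cast at hlamX
    -- The gap between the two bounds, scaled by `a_1`; `(n - l) a_1 < X` bounds `(n - l) a_p`.
    have key : (highMargin a : ℚ) ≤ l * a (Fin.last (m + 2)) - (n * a 0 + X : ℕ) := by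
      push_cast
      refine le_of_mul_le_mul_left ?_ h0
      have e1 := mul_le_mul_of_nonneg_left hN h0.le
      have e2 := mul_le_mul_of_nonneg_left (not_le.1 hc).le (h0.trans hD).le
      have e3 := mul_le_mul_of_nonneg_left hl1 h0.le
      have e4 : (0 : ℚ) ≤ a 0 * (a (Fin.last (m + 2)) - a 0) := mul_nonneg h0.le (by linarith)
      have e5 := mul_nonneg h0.le had
      have e6 := mul_nonneg h0.le hapd
      nlinarith
    have hln' : (l : ℚ) * a (Fin.last (m + 2)) ≤ n * a (Fin.last (m + 2)) :=
      mul_le_mul_of_nonneg_right (by exact_mod_cast hln) (by positivity)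
    have hln'' : (l : ℤ) * a 0 ≤ n * a 0 :=
      mul_le_mul_of_nonneg_right (by exact_mod_cast hln) (by positivity)
    refine ⟨n * a 0 + X, hasLength_of_margins ha ?_ ?_ ?_, hasLength_of_margins ha ?_ ?_ ?_, ?_⟩
    · push_cast
      simpa using hXd
    · push_cast
      linarith
    · have : (highMargin a : ℚ) ≤ n * a (Fin.last (m + 2)) - (n * a 0 + X : ℕ) := by linarith
      exact_mod_cast this
    · push_cast
      rw [add_sub_right_comm]
      exact dvd_add hdl hXd
    · push_cast
      linarith
    · exact_mod_cast key
    · refine Or.inl ⟨?_, ?_⟩ <;> push_cast <;> linarith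

/-- The counterpart of `exists_mem_edges_of_le` for `l ≥ n`, with the elements `n a_p` and
`n a_p - Y`. -/
theorem exists_mem_edges_of_ge (ha_pos : 0 < a 0) (ha : StrictMono a) {n l : ℕ} (hn : N₀ a ≤ n)
    (hd : (d a : ℤ) ∣ (l : ℤ) - n) (hln : n ≤ l)
    (h : (l : ℚ) * a 0 ≤ n * a (Fin.last (m + 2)) - lam₂ a + a 0 * d a) :
    ∃ s, HasLength a n s ∧ HasLength a l s ∧ (s : ℚ) ∈ edges a n := by
  have hN := le_mul_of_N₀_le ha hn
  have h0 : (0 : ℚ) < a 0 := by exact_mod_cast ha_pos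
  have hD : (a 0 : ℚ) < a (Fin.last (m + 2)) := by exact_mod_cast zero_lt_last ha
  have hX : (0 : ℚ) ≤ lowMargin a := by exact_mod_cast lowMargin_nonneg ha
  have hY : (0 : ℚ) ≤ highMargin a := by exact_mod_cast highMargin_nonneg ha
  have had : (0 : ℚ) ≤ a 0 * d a := by positivity
  have hapd : (0 : ℚ) ≤ a (Fin.last (m + 2)) * d a := by positivity
  have hl1 := lowMargin_le_lam₁ ha_pos ha
  have hl2 := lowMargin_le_lam₂ ha_pos ha
  have hl3 := highMargin_le_lam₂ ha_pos ha
  have hnD : (d a : ℤ) ∣ (n : ℤ) * a (Fin.last (m + 2)) - n * a 0 := by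
    rw [← mul_sub]
    exact (d_dvd_sub ha _).mul_left _
  have hdl : (d a : ℤ) ∣ (n : ℤ) * a (Fin.last (m + 2)) - l * a 0 := by
    rw [show (n : ℤ) * a (Fin.last (m + 2)) - l * a 0
      = n * a (Fin.last (m + 2)) - n * a 0 - (l - n) * a 0 by ring]
    exact dvd_sub hnD (hd.mul_right _)
  by_cases hc : (highMargin a : ℚ) ≤ l * a (Fin.last (m + 2)) - n * a (Fin.last (m + 2))
  · refine ⟨n * a (Fin.last (m + 2)), hasLength_of_three a 0 0 0 n (by ring) (by ring),
      hasLength_of_margins ha (by exact_mod_cast hdl) ?_ (by exact_mod_cast hc), ?_⟩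
    · have : (lowMargin a : ℚ) ≤ (n * a (Fin.last (m + 2)) : ℕ) - l * a 0 := by
        push_cast; linarith
      exact_mod_cast this
    · refine Or.inr ⟨?_, ?_⟩ <;> push_cast <;> linarith
  · have hYd := d_dvd_highMargin ha
    obtain ⟨s, hs⟩ : ∃ s : ℕ, (n : ℤ) * a (Fin.last (m + 2)) - highMargin a = s := by
      refine Int.eq_ofNat_of_zero_le ?_
      have : (0 : ℚ) ≤ n * a (Fin.last (m + 2)) - highMargin a := by
        have : (0 : ℚ) ≤ n * a 0 := by positivity
        linarith
      exact_mod_cast this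
    have hsq : (s : ℚ) = n * a (Fin.last (m + 2)) - highMargin a := by exact_mod_cast hs.symm
    have hln' : (n : ℤ) * a (Fin.last (m + 2)) ≤ l * a (Fin.last (m + 2)) :=
      mul_le_mul_of_nonneg_right (by exact_mod_cast hln) (by positivity)
    have hln'' : (n : ℚ) * a 0 ≤ l * a 0 :=
      mul_le_mul_of_nonneg_right (by exact_mod_cast hln) (by positivity)
    -- As `a_1 < a_p`, the failing condition gives `(l - n) a_1 ≤ (l - n) a_p < Y`.
    have key : (lowMargin a : ℚ) ≤ s - l * a 0 := by
      have : (0 : ℚ) ≤ ((l : ℚ) - n) * (a (Fin.last (m + 2)) - a 0) :=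
        mul_nonneg (sub_nonneg.2 (by exact_mod_cast hln)) (by linarith)
      have hc' := not_le.1 hc
      have hm := mul_margins_le_mul_lam₂ ha_pos ha
      have : (lowMargin a : ℚ) + highMargin a ≤ lam₂ a := by
        refine le_of_mul_le_mul_left (le_trans ?_ hm) h0
        have := mul_le_mul_of_nonneg_right hD.le hX
        have := mul_nonneg (h0.trans hD).le had
        have := mul_nonneg h0.le hapd
        nlinarith
      nlinarith
    refine ⟨s, hasLength_of_margins ha ?_ ?_ ?_, hasLength_of_margins ha ?_ ?_ ?_, ?_⟩
    · rw [← hs, sub_right_comm]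
      exact dvd_sub hnD hYd
    · have : (lowMargin a : ℚ) ≤ s - n * a 0 := by linarith
      exact_mod_cast this
    · linarith
    · rw [← hs, sub_right_comm]
      exact dvd_sub hdl hYd
    · exact_mod_cast key
    · linarith
    · refine Or.inr ⟨?_, ?_⟩ <;> linarith

theorem exists_mem_edges (ha_pos : 0 < a 0) (ha : StrictMono a) {n l : ℕ} (hn : N₀ a ≤ n)
    (hd : (d a : ℤ) ∣ (l : ℤ) - n)
    (h : n * a 0 + lam₁ a - a (Fin.last (m + 2)) * d a ≤ (l : ℚ) * a (Fin.last (m + 2)))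
    (h' : (l : ℚ) * a 0 ≤ n * a (Fin.last (m + 2)) - lam₂ a + a 0 * d a) :
    ∃ s, HasLength a n s ∧ HasLength a l s ∧ (s : ℚ) ∈ edges a n := by
  rcases le_total l n with hln | hln
  · exact exists_mem_edges_of_le ha_pos ha hn hd hln h
  · exact exists_mem_edges_of_ge ha_pos ha hn hd hln h'

theorem mem_nu_of_bounds (ha_pos : 0 < a 0) (ha : StrictMono a) {n l : ℕ} (hn : N₀ a ≤ n)
    (hd : (d a : ℤ) ∣ (l : ℤ) - n)
    (h : n * a 0 + lam₁ a - a (Fin.last (m + 2)) * d a ≤ (l : ℚ) * a (Fin.last (m + 2)))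
    (h' : (l : ℚ) * a 0 ≤ n * a (Fin.last (m + 2)) - lam₂ a + a 0 * d a) : l ∈ nu a n := by
  obtain ⟨s, h1, h2, -⟩ := exists_mem_edges ha_pos ha hn hd h h'
  exact (mem_nu_iff a).2 ⟨s, h1, h2⟩

/-- Both `n` and `n - d` lie strictly between the thresholds, so that the middle part of `ν(n)` has
at least two elements. -/
theorem exists_add_d_eq (ha_pos : 0 < a 0) (ha : StrictMono a) {n : ℕ} (hn : N₀ a ≤ n) :
    ∃ l : ℕ, l + d a = n ∧ (n * a 0 + lam₁ a : ℚ) < l * a (Fin.last (m + 2)) ∧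
      (n : ℚ) * a 0 < n * a (Fin.last (m + 2)) - lam₂ a := by
  have hN := le_mul_of_N₀_le ha hn
  have h0 : (0 : ℚ) < a 0 := by exact_mod_cast ha_pos
  have hD : (a 0 : ℚ) < a (Fin.last (m + 2)) := by exact_mod_cast zero_lt_last ha
  have hX : (0 : ℚ) ≤ lowMargin a := by exact_mod_cast lowMargin_nonneg ha
  have hY : (0 : ℚ) ≤ highMargin a := by exact_mod_cast highMargin_nonneg ha
  have had : (0 : ℚ) ≤ a 0 * d a := by positivity
  have hl1 := lowMargin_le_lam₁ ha_pos ha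
  have hl3 := highMargin_le_lam₂ ha_pos ha
  have hna : (0 : ℚ) ≤ n * a 0 := by positivity
  have hle : d a ≤ n := by
    have : (d a : ℚ) * a (Fin.last (m + 2)) ≤ n * a (Fin.last (m + 2)) := by linarith
    exact_mod_cast le_of_mul_le_mul_right this (h0.trans hD)
  refine ⟨n - d a, Nat.sub_add_cancel hle, ?_, by linarith⟩
  rw [Nat.cast_sub hle, sub_mul]
  linarith

theorem HasLength.mul_le_cast {l s : ℕ} (ha : StrictMono a) (h : HasLength a l s) :
    (l : ℚ) * a 0 ≤ s := by
  exact_mod_cast h.mul_le ha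

theorem HasLength.le_mul_cast {l s : ℕ} (ha : StrictMono a) (h : HasLength a l s) :
    (s : ℚ) ≤ l * a (Fin.last (m + 2)) := by
  exact_mod_cast h.le_mul ha

/-- All of `ν(n)` is realised by elements in the edges: a length beyond a threshold can only come
from an edge, and the other lengths are provided by `exists_mem_edges`. -/
theorem length_image_factorizationsOver_edges (ha_pos : 0 < a 0) (ha : StrictMono a)
    (hgcd : Finset.univ.gcd a = 1) {n : ℕ} (hn : N₀ a ≤ n) :
    length '' factorizationsOver a n (edges a n) = nu a n := by
  ext l
  rw [mem_length_factorizationsOver_iff]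
  refine ⟨fun ⟨s, h1, h2, _⟩ => (mem_nu_iff a).2 ⟨s, h1, h2⟩, fun hl => ?_⟩
  obtain ⟨s, h1, h2⟩ := (mem_nu_iff a).1 hl
  have b1 := h1.mul_le_cast ha
  have b2 := h1.le_mul_cast ha
  have b3 := h2.mul_le_cast ha
  have b4 := h2.le_mul_cast ha
  by_cases c1 : (l : ℚ) * a (Fin.last (m + 2)) < n * a 0 + lam₁ a
  · exact ⟨s, h1, h2, Or.inl ⟨b1, by linarith⟩⟩
  by_cases c2 : n * a (Fin.last (m + 2)) - lam₂ a < (l : ℚ) * a 0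
  · exact ⟨s, h1, h2, Or.inr ⟨by linarith, b2⟩⟩
  have had : (0 : ℚ) ≤ a 0 * d a := by positivity
  have hapd : (0 : ℚ) ≤ a (Fin.last (m + 2)) * d a := by positivity
  exact exists_mem_edges ha_pos ha hn (d_dvd_of_mem_nu ha hgcd hl) (by linarith) (by linarith)

/-! ### Lengths of the elements between the edges -/

/-- An open interval of length at least `D` with positive right end contains one of the numbers
`j D`, `j D + e` with `j ≥ 0`, for any given `0 < e < D`. -/
theorem exists_mul_add_mem_window {D e w w' : ℚ} (he : 0 < e) (heD : e < D) (hw' : 0 < w')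
    (hww' : w + D ≤ w') :
    ∃ j ε : ℕ, ε ≤ 1 ∧ w < j * D + ε * e ∧ j * D + ε * e < w' := by
  rcases lt_or_ge w 0 with hw | hw
  · exact ⟨0, 0, by simp, by simpa using hw, by simpa using hw'⟩
  have hD : 0 < D := he.trans heD
  have h1 : (⌊w / D⌋₊ : ℚ) * D ≤ w := (le_div_iff₀ hD).1 (Nat.floor_le (div_nonneg hw hD.le))
  have h2 : w < (⌊w / D⌋₊ + 1) * D := (div_lt_iff₀ hD).1 (Nat.lt_floor_add_one _)
  by_cases h3 : (⌊w / D⌋₊ + 1 : ℚ) * D < w'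
  · exact ⟨⌊w / D⌋₊ + 1, 0, by simp, by push_cast; linarith, by push_cast; linarith⟩
  · exact ⟨⌊w / D⌋₊, 1, le_rfl, by push_cast; linarith, by push_cast; linarith⟩

theorem hasLength_of_mem_inner (ha_pos : 0 < a 0) (ha : StrictMono a) {n l s : ℕ}
    (hd : (d a : ℤ) ∣ (l : ℤ) - n) (hl : HasLength a l s) (hs : (s : ℚ) ∈ inner a n) :
    HasLength a n s := by
  obtain ⟨h1, h2⟩ := hs
  have had : (0 : ℚ) ≤ a 0 * d a := by positivity
  have hapd : (0 : ℚ) ≤ a (Fin.last (m + 2)) * d a := by positivity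
  have hl1 := lowMargin_le_lam₁ ha_pos ha
  have hl3 := highMargin_le_lam₂ ha_pos ha
  refine hasLength_of_margins ha ?_ ?_ ?_
  · rw [show (s : ℤ) - n * a 0 = s - l * a 0 + (l - n) * a 0 by ring]
    exact dvd_add (hl.d_dvd ha) (hd.mul_right _)
  · have : (lowMargin a : ℚ) ≤ s - n * a 0 := by linarith
    exact_mod_cast this
  · have : (highMargin a : ℚ) ≤ n * a (Fin.last (m + 2)) - s := by linarith
    exact_mod_cast this

/-- For `l ≤ n` above the lower threshold, the element is `l a_p - t` with `t = j (a_p - a_1)` or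
`t = j (a_p - a_1) + (a_p - a_{p-1})`. -/
theorem exists_mem_inner_of_le (ha_pos : 0 < a 0) (ha : StrictMono a) {n l : ℕ} (hn : N₀ a ≤ n)
    (hln : l ≤ n) (h : (n * a 0 + lam₁ a : ℚ) < l * a (Fin.last (m + 2))) :
    ∃ s, HasLength a l s ∧ (s : ℚ) ∈ inner a n := by
  have hN := le_mul_of_N₀_le ha hn
  have hD : (a 0 : ℚ) < a (Fin.last (m + 2)) := by exact_mod_cast zero_lt_last ha
  have hb := penultimate_lt_last ha
  have hb' := zero_lt_penultimate ha
  have hX : (0 : ℚ) ≤ lowMargin a := by exact_mod_cast lowMargin_nonneg ha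
  have had : (0 : ℚ) ≤ a 0 * d a := by positivity
  have hl1 := lowMargin_le_lam₁ ha_pos ha
  obtain ⟨j, ε, hε, h1, h2⟩ := exists_mul_add_mem_window
    (D := a (Fin.last (m + 2)) - a 0)
    (e := a (Fin.last (m + 2)) - a (Fin.last (m + 1)).castSucc)
    (w := l * a (Fin.last (m + 2)) - n * a (Fin.last (m + 2)) + lam₂ a)
    (w' := l * a (Fin.last (m + 2)) - n * a 0 - lam₁ a)
    (by linarith) (by linarith) (by linarith) (by linarith)
  have hjl : j < l := by
    have hln' : (l : ℚ) * a 0 ≤ n * a 0 :=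
      mul_le_mul_of_nonneg_right (by exact_mod_cast hln) (by positivity)
    have : (0 : ℚ) ≤ ε * (a (Fin.last (m + 2)) - a (Fin.last (m + 1)).castSucc) :=
      mul_nonneg (by positivity) (by linarith)
    have : (j : ℚ) * (a (Fin.last (m + 2)) - a 0) < l * (a (Fin.last (m + 2)) - a 0) := by
      rw [mul_sub (l : ℚ)]
      linarith
    exact_mod_cast lt_of_mul_lt_mul_right this (by linarith)
  obtain ⟨k, rfl⟩ : ∃ k, l = j + ε + k := Nat.exists_eq_add_of_le (by omega)
  refine ⟨_, hasLength_of_three a (Fin.last (m + 1)).castSucc j ε k rfl rfl, ?_, ?_⟩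
  · push_cast at h2 ⊢
    linarith
  · push_cast at h1 ⊢
    linarith

/-- For `l ≥ n` below the upper threshold, the element is `l a_1 + t` with `t = j (a_p - a_1)` or
`t = j (a_p - a_1) + (a_2 - a_1)`. -/
theorem exists_mem_inner_of_ge (ha_pos : 0 < a 0) (ha : StrictMono a) {n l : ℕ} (hn : N₀ a ≤ n)
    (hln : n ≤ l) (h : (l : ℚ) * a 0 < n * a (Fin.last (m + 2)) - lam₂ a) :
    ∃ s, HasLength a l s ∧ (s : ℚ) ∈ inner a n := by
  have hN := le_mul_of_N₀_le ha hn
  have hD : (a 0 : ℚ) < a (Fin.last (m + 2)) := by exact_mod_cast zero_lt_last ha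
  have hb := zero_lt_one_index ha
  have hb' : (a 1 : ℚ) < a (Fin.last (m + 2)) := by
    exact_mod_cast ha (by simp [Fin.lt_def])
  have hX : (0 : ℚ) ≤ lowMargin a := by exact_mod_cast lowMargin_nonneg ha
  have had : (0 : ℚ) ≤ a 0 * d a := by positivity
  have hl2 := lowMargin_le_lam₂ ha_pos ha
  obtain ⟨j, ε, hε, h1, h2⟩ := exists_mul_add_mem_window
    (D := a (Fin.last (m + 2)) - a 0) (e := a 1 - a 0)
    (w := n * a 0 + lam₁ a - l * a 0)
    (w' := n * a (Fin.last (m + 2)) - lam₂ a - l * a 0)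
    (by linarith) (by linarith) (by linarith) (by linarith)
  have hjl : j < l := by
    have hln' : (n : ℚ) * a (Fin.last (m + 2)) ≤ l * a (Fin.last (m + 2)) :=
      mul_le_mul_of_nonneg_right (by exact_mod_cast hln) (by positivity)
    have : (0 : ℚ) ≤ ε * (a 1 - a 0) := mul_nonneg (by positivity) (by linarith)
    have hlt : (j : ℚ) * (a (Fin.last (m + 2)) - a 0) < l * (a (Fin.last (m + 2)) - a 0) := by
      rw [mul_sub (l : ℚ)]
      have : 0 < lam₂ a := by
        have : (0 : ℚ) < a 0 * d a := by
          exact_mod_cast Nat.mul_pos ha_pos (d_pos ha)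
        linarith
      linarith
    exact_mod_cast lt_of_mul_lt_mul_right hlt (by linarith)
  obtain ⟨k, rfl⟩ : ∃ k, l = j + ε + k := Nat.exists_eq_add_of_le (by omega)
  refine ⟨_, hasLength_of_three a 1 k ε j rfl (by ring), ?_, ?_⟩
  · push_cast at h1 ⊢
    linarith
  · push_cast at h2 ⊢
    linarith

/-- The lengths over the open interval between the edges form an arithmetic progression. -/
theorem mem_length_inner_iff (ha_pos : 0 < a 0) (ha : StrictMono a)
    (hgcd : Finset.univ.gcd a = 1) {n l : ℕ} (hn : N₀ a ≤ n) :
    l ∈ length '' factorizationsOver a n (inner a n) ↔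
      (d a : ℤ) ∣ (l : ℤ) - n ∧ (n * a 0 + lam₁ a : ℚ) < l * a (Fin.last (m + 2)) ∧
        (l : ℚ) * a 0 < n * a (Fin.last (m + 2)) - lam₂ a := by
  rw [mem_length_factorizationsOver_iff]
  constructor
  · rintro ⟨s, h1, h2, h3, h4⟩
    have b3 := h2.mul_le_cast ha
    have b4 := h2.le_mul_cast ha
    exact ⟨d_dvd_of_mem_nu ha hgcd ((mem_nu_iff a).2 ⟨s, h1, h2⟩), by linarith, by linarith⟩
  · rintro ⟨hd, h1, h2⟩
    obtain ⟨s, h3, h4⟩ : ∃ s, HasLength a l s ∧ (s : ℚ) ∈ inner a n := by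
      rcases le_total l n with hln | hln
      · exact exists_mem_inner_of_le ha_pos ha hn hln h1
      · exact exists_mem_inner_of_ge ha_pos ha hn hln h2
    exact ⟨s, hasLength_of_mem_inner ha_pos ha hd h3 h4, h3, h4⟩

theorem deltaFact_inner (ha_pos : 0 < a 0) (ha : StrictMono a) (hgcd : Finset.univ.gcd a = 1)
    {n : ℕ} (hn : N₀ a ≤ n) : deltaFact (factorizationsOver a n (inner a n)) = {d a} := by
  have hiff := fun l => mem_length_inner_iff ha_pos ha hgcd (l := l) hn
  obtain ⟨l₀, hl₀, h1, h2⟩ := exists_add_d_eq ha_pos ha hn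
  have hl₀n : (l₀ : ℚ) + d a = n := by exact_mod_cast hl₀
  have hd0 : (0 : ℚ) ≤ d a := by positivity
  have hmono : ∀ {x y : ℚ} (i : Fin (m + 3)), x ≤ y → x * a i ≤ y * a i :=
    fun i h => mul_le_mul_of_nonneg_right h (by positivity)
  refine delta_eq_singleton (d_pos ha) ?_ ?_ (l₀ := l₀) ?_ ?_
  · intro l hl l' hl'
    simpa using dvd_sub ((hiff l').1 hl').1 ((hiff l).1 hl).1
  · intro l hl l' hl' hlt
    obtain ⟨e1, e2, -⟩ := (hiff l).1 hl
    obtain ⟨e1', -, e3'⟩ := (hiff l').1 hl'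
    have hle : (l : ℤ) + d a ≤ l' := by
      have := Int.le_of_dvd (by omega) (dvd_sub e1' e1)
      omega
    have hle' : (l : ℚ) + d a ≤ l' := by exact_mod_cast hle
    refine (hiff _).2 ⟨?_, ?_, ?_⟩
    · push_cast
      rw [add_sub_right_comm]
      exact dvd_add e1 dvd_rfl
    · push_cast
      linarith [hmono (x := l) (y := l + d a) (Fin.last (m + 2)) (by linarith)]
    · push_cast
      linarith [hmono 0 hle']
  · refine (hiff _).2 ⟨by rw [← hl₀]; simp, h1, ?_⟩
    linarith [hmono (x := l₀) (y := n) 0 (by linarith)]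
  · rw [hl₀]
    refine (hiff _).2 ⟨by simp, ?_, h2⟩
    linarith [hmono (x := l₀) (y := n) (Fin.last (m + 2)) (by linarith)]

/-! ### The three parts of `ν(n)` -/

theorem mem_lowerPart_iff (ha : StrictMono a) {n l : ℕ} :
    l ∈ lowerPart a n ↔
      l ∈ nu a n ∧ (l : ℚ) * a (Fin.last (m + 2)) < n * a 0 + lam₁ a := by
  have hD : (a 0 : ℚ) < a (Fin.last (m + 2)) := by exact_mod_cast zero_lt_last ha
  have h0 : (0 : ℚ) ≤ a 0 := by positivity
  exact and_congr_right fun _ => lt_div_iff₀ (by linarith)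

theorem mem_upperPart_iff (ha_pos : 0 < a 0) {n l : ℕ} :
    l ∈ upperPart a n ↔
      l ∈ nu a n ∧ n * a (Fin.last (m + 2)) - lam₂ a < (l : ℚ) * a 0 :=
  and_congr_right fun _ => div_lt_iff₀ (by exact_mod_cast ha_pos)

theorem mem_middlePart_iff (ha_pos : 0 < a 0) (ha : StrictMono a) {n l : ℕ} :
    l ∈ middlePart a n ↔
      l ∈ nu a n ∧ (n * a 0 + lam₁ a : ℚ) ≤ l * a (Fin.last (m + 2)) ∧
        (l : ℚ) * a 0 ≤ n * a (Fin.last (m + 2)) - lam₂ a := by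
  rw [middlePart, Set.mem_sdiff, Set.mem_union, mem_lowerPart_iff ha, mem_upperPart_iff ha_pos]
  constructor
  · rintro ⟨h1, h2⟩
    refine ⟨h1, not_lt.1 fun h => h2 (Or.inr ⟨h1, h⟩), not_lt.1 fun h => h2 (Or.inl ⟨h1, h⟩)⟩
  · rintro ⟨h1, h2, h3⟩
    exact ⟨h1, fun h => h.elim (fun h => not_lt.2 h3 h.2) fun h => not_lt.2 h2 h.2⟩

theorem delta_middlePart (ha_pos : 0 < a 0) (ha : StrictMono a) (hgcd : Finset.univ.gcd a = 1)
    {n : ℕ} (hn : N₀ a ≤ n) : delta (middlePart a n) = {d a} := by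
  have hiff := fun l => mem_middlePart_iff ha_pos ha (n := n) (l := l)
  obtain ⟨l₀, hl₀, h1, h2⟩ := exists_add_d_eq ha_pos ha hn
  have hl₀n : (l₀ : ℚ) + d a = n := by exact_mod_cast hl₀
  have hd0 : (0 : ℚ) ≤ d a := by positivity
  have hmono : ∀ {x y : ℚ} (i : Fin (m + 3)), x ≤ y → x * a i ≤ y * a i :=
    fun i h => mul_le_mul_of_nonneg_right h (by positivity)
  have had : (0 : ℚ) ≤ a 0 * d a := by positivity
  have hapd : (0 : ℚ) ≤ a (Fin.last (m + 2)) * d a := by positivity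
  have hof : ∀ l : ℕ, (d a : ℤ) ∣ (l : ℤ) - n →
      (n * a 0 + lam₁ a : ℚ) ≤ l * a (Fin.last (m + 2)) →
      (l : ℚ) * a 0 ≤ n * a (Fin.last (m + 2)) - lam₂ a → l ∈ middlePart a n :=
    fun l e1 e2 e3 => (hiff l).2
      ⟨mem_nu_of_bounds ha_pos ha hn e1 (by linarith) (by linarith), e2, e3⟩
  refine delta_eq_singleton (d_pos ha) ?_ ?_ (l₀ := l₀) ?_ ?_
  · intro l hl l' hl'
    simpa using dvd_sub (d_dvd_of_mem_nu ha hgcd hl'.1) (d_dvd_of_mem_nu ha hgcd hl.1)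
  · intro l hl l' hl' hlt
    have e1 := d_dvd_of_mem_nu ha hgcd hl.1
    obtain ⟨-, e2, -⟩ := (hiff l).1 hl
    obtain ⟨-, -, e3'⟩ := (hiff l').1 hl'
    have hle : (l : ℤ) + d a ≤ l' := by
      have := Int.le_of_dvd (by omega) (dvd_sub (d_dvd_of_mem_nu ha hgcd hl'.1) e1)
      omega
    have hle' : (l : ℚ) + d a ≤ l' := by exact_mod_cast hle
    refine hof _ ?_ ?_ ?_
    · push_cast
      rw [add_sub_right_comm]
      exact dvd_add e1 dvd_rfl
    · push_cast
      linarith [hmono (x := l) (y := l + d a) (Fin.last (m + 2)) (by linarith)]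
    · push_cast
      linarith [hmono 0 hle']
  · refine hof _ (by rw [← hl₀]; simp) h1.le ?_
    linarith [hmono (x := l₀) (y := n) 0 (by linarith)]
  · rw [hl₀]
    refine hof _ (by simp) ?_ h2.le
    linarith [hmono (x := l₀) (y := n) (Fin.last (m + 2)) (by linarith)]

/-- Consecutive elements of `ν(n)` in different parts differ by `d`, because the middle part can be
continued by one step of size `d` inside `ν(n)` on either side. -/
theorem delta_nu_eq_union (ha_pos : 0 < a 0) (ha : StrictMono a) (hgcd : Finset.univ.gcd a = 1)
    {n : ℕ} (hn : N₀ a ≤ n) :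
    delta (nu a n) =
      delta (upperPart a n) ∪ delta (middlePart a n) ∪ delta (lowerPart a n) := by
  have hmid := fun l => mem_middlePart_iff ha_pos ha (n := n) (l := l)
  have hlow := fun l => mem_lowerPart_iff ha (n := n) (l := l)
  have hupp := fun l => mem_upperPart_iff (a := a) ha_pos (n := n) (l := l)
  have hmono : ∀ {x y : ℕ} (i : Fin (m + 3)), x ≤ y → (x : ℚ) * a i ≤ y * a i :=
    fun i h => mul_le_mul_of_nonneg_right (by exact_mod_cast h) (by positivity)
  have hd := d_pos ha
  have had : (0 : ℚ) ≤ a 0 * d a := by positivity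
  have hapd : (0 : ℚ) ≤ a (Fin.last (m + 2)) * d a := by positivity
  apply Set.Subset.antisymm
  · rintro t ⟨l, hl, l', hl', hlt, hno, rfl⟩
    have hle : (d a : ℤ) ≤ l' - l := by
      have := dvd_sub (d_dvd_of_mem_nu ha hgcd hl') (d_dvd_of_mem_nu ha hgcd hl)
      rw [sub_sub_sub_cancel_right] at this
      exact Int.le_of_dvd (by omega) this
    have hll := hmono (Fin.last (m + 2)) hlt.le
    have hll0 := hmono 0 hlt.le
    have hgap : l' - l = d a → l' - l ∈
        delta (upperPart a n) ∪ delta (middlePart a n) ∪ delta (lowerPart a n) := by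
      intro h
      rw [h, delta_middlePart ha_pos ha hgcd hn]
      exact Or.inl (Or.inr rfl)
    obtain ⟨l₀, hl₀, h1, h2⟩ := exists_add_d_eq ha_pos ha hn
    have hn1 : (n * a 0 + lam₁ a : ℚ) < n * a (Fin.last (m + 2)) :=
      h1.trans_le (hmono _ (by omega))
    have hnn : n ∈ nu a n := mem_nu_of_bounds ha_pos ha hn (by simp) (by linarith) (by linarith)
    by_cases c1 : (l : ℚ) * a (Fin.last (m + 2)) < n * a 0 + lam₁ a
    · by_cases c2 : (l' : ℚ) * a (Fin.last (m + 2)) < n * a 0 + lam₁ a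
      · exact Or.inr ⟨l, (hlow l).2 ⟨hl, c1⟩, l', (hlow l').2 ⟨hl', c2⟩, hlt,
          fun y hy => hno y hy.1, rfl⟩
      · -- The pair crosses the lower threshold, so `l' ≤ n`, and `l' - d` belongs to `ν(n)`.
        have hln : l < n := by
          by_contra hc
          linarith [hmono (Fin.last (m + 2)) (not_lt.1 hc)]
        have hln' : l' ≤ n := by
          by_contra hc
          exact hno n hnn ⟨hln, by omega⟩
        have hcast : ((l' - d a : ℕ) : ℚ) = l' - d a := Nat.cast_sub (by omega)
        have hmem : l' - d a ∈ nu a n := by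
          refine mem_nu_of_bounds ha_pos ha hn ?_ ?_ ?_
          · rw [Nat.cast_sub (by omega), sub_right_comm]
            exact dvd_sub (d_dvd_of_mem_nu ha hgcd hl') dvd_rfl
          · rw [hcast, sub_mul]
            linarith
          · linarith [hmono 0 (show l' - d a ≤ n by omega)]
        have := hno _ hmem
        exact hgap (by omega)
    by_cases c3 : n * a (Fin.last (m + 2)) - lam₂ a < (l' : ℚ) * a 0
    · by_cases c4 : n * a (Fin.last (m + 2)) - lam₂ a < (l : ℚ) * a 0
      · exact Or.inl (Or.inl ⟨l, (hupp l).2 ⟨hl, c4⟩, l', (hupp l').2 ⟨hl', c3⟩, hlt,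
          fun y hy => hno y hy.1, rfl⟩)
      · -- The pair crosses the upper threshold, and `l + d` belongs to `ν(n)`.
        have hmem : l + d a ∈ nu a n := by
          refine mem_nu_of_bounds ha_pos ha hn ?_ ?_ ?_
          · push_cast
            rw [add_sub_right_comm]
            exact dvd_add (d_dvd_of_mem_nu ha hgcd hl) dvd_rfl
          · push_cast
            linarith
          · push_cast
            linarith
        have := hno _ hmem
        exact hgap (by omega)
    · refine Or.inl (Or.inr ⟨l, (hmid l).2 ⟨hl, by linarith, by linarith⟩, l',
        (hmid l').2 ⟨hl', by linarith, by linarith⟩, hlt, fun y hy => hno y hy.1, rfl⟩)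
  · refine Set.union_subset (Set.union_subset ?_ ?_) ?_
    · refine delta_subset_of_ordConvex (fun l h => h.1) fun l hl l' _ y hy h1 _ => ?_
      have := ((hupp l).1 hl).2
      exact (hupp y).2 ⟨hy, by linarith [hmono 0 h1.le]⟩
    · refine delta_subset_of_ordConvex (fun l h => h.1) fun l hl l' hl' y hy h1 h2 => ?_
      have e1 := ((hmid l).1 hl).2.1
      have e2 := ((hmid l').1 hl').2.2
      exact (hmid y).2 ⟨hy, by linarith [hmono (Fin.last (m + 2)) h1.le],
        by linarith [hmono 0 h2.le]⟩
    · refine delta_subset_of_ordConvex (fun l h => h.1) fun l _ l' hl' y hy _ h2 => ?_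
      have := ((hlow l').1 hl').2
      exact (hlow y).2 ⟨hy, by linarith [hmono (Fin.last (m + 2)) h2.le]⟩

end NumSemigroup

theorem mainTheorem2 {m : ℕ} (a : Fin (m + 3) → ℕ) (ha_pos : 0 < a 0) (ha_mono : StrictMono a)
    (ha_gcd : Finset.univ.gcd a = 1) (n : ℕ) (hn : NumSemigroup.N₀ a ≤ (n : ℚ)) :
    NumSemigroup.delta (NumSemigroup.nu a n) =
        NumSemigroup.deltaFact
          (NumSemigroup.factorizationsOver a n (NumSemigroup.edges a n)) ∧
      NumSemigroup.deltaFact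
          (NumSemigroup.factorizationsOver a n (NumSemigroup.inner a n)) = {NumSemigroup.d a} ∧
      NumSemigroup.delta (NumSemigroup.middlePart a n) = {NumSemigroup.d a} ∧
      NumSemigroup.delta (NumSemigroup.nu a n) =
        NumSemigroup.delta (NumSemigroup.upperPart a n) ∪
          NumSemigroup.delta (NumSemigroup.middlePart a n) ∪
          NumSemigroup.delta (NumSemigroup.lowerPart a n) := by
  refine ⟨?_, NumSemigroup.deltaFact_inner ha_pos ha_mono ha_gcd hn,
    NumSemigroup.delta_middlePart ha_pos ha_mono ha_gcd hn,
    NumSemigroup.delta_nu_eq_union ha_pos ha_mono ha_gcd hn⟩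
  rw [NumSemigroup.deltaFact,
    NumSemigroup.length_image_factorizationsOver_edges ha_pos ha_mono ha_gcd hn]
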